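/- An (open or closed) half-space of $\mathbb{R}^3$ is a set of the form $\{x : \langle a,x\rangle \le b\}$ or $\{x : \langle a,x\rangle < b\}$ with $a \in \mathbb{R}^3\setminus\{0\}$ and $b\in\mathbb{R}$. Sets $S_1,\ldots,S_r$ form an $r$-sunflower if they are pairwise distinct and $S_i\cap S_j = S_{i'}\cap S_{j'}$ for all $i\neq j$ and $i'\neq j'$. Theorem. For each integer $r > 2$ there is a constant $C = C(r) > 0$, depending only on $r$, with the following property. Let $k \ge 1$ and $N$ be integers, let $V \subseteq \mathbb{R}^3$ be any set of points, and let $H_1,\ldots,H_N$ be half-spaces of $\mathbb{R}^3$ such that the sets $S_i = H_i \cap V$ are pairwise distinct and $|S_i| = k$ for all $i$. If $N \ge C^k$, then there are indices $i_1,\ldots,i_r$ such that $S_{i_1},\ldots,S_{i_r}$ form an $r$-sunflower. -/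

import Mathlib

/-- An open or closed half-space of `ℝ³`: the set of points on one side of the plane
`⟪a, x⟫ = b` with normal vector `a ≠ 0`, with or without the plane itself. -/
def IsHalfSpace (H : Set (EuclideanSpace ℝ (Fin 3))) : Prop :=
  ∃ (a : EuclideanSpace ℝ (Fin 3)) (b : ℝ), a ≠ 0 ∧
    (H = {x | inner ℝ a x ≤ b} ∨ H = {x | inner ℝ a x < b})

/-- The sets `S 0, …, S (r - 1)` form an `r`-sunflower: they are pairwise distinct, and the
intersections of any two of them are all the same. -/
def IsSunflower {α : Type*} (r : ℕ) (S : Fin r → Set α) : Prop :=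
  Function.Injective S ∧
    ∀ i j i' j' : Fin r, i ≠ j → i' ≠ j' → S i ∩ S j = S i' ∩ S j'

/-! Induct on `k`. If some point of `V` lies in more than a fraction 1/K of the half-spaces, keep
those, delete the point from `V`, and put it back into the core of the sunflower found. Otherwise a
union bound gives `m` half-spaces such that the witness chosen for each intersecting pair lies in no
third one. By Ramsey, either `r` traces are pairwise disjoint, a sunflower with empty core, or 31
meet pairwise, each pair at a point private to it. `not_pairwise_exists_mem_iff` excludes the latter
by linear dependence in dimension 4: evaluated at the private points, a dependence among five pairs
(normal, bound) must have three positive and three negative coefficients. -/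

open Finset in
/-- **Ramsey's theorem** for two colours. -/
theorem exists_ramsey_number (s t : ℕ) : ∃ n : ℕ, ∀ {α : Type} (R : α → α → Prop)
    (_ : ∀ x y, R x y → R y x) (A : Finset α), n ≤ #A →
    ∃ B ⊆ A, (#B = s ∧ (B : Set α).Pairwise R) ∨
      (#B = t ∧ (B : Set α).Pairwise fun x y => ¬ R x y) := by
  classical
  induction s generalizing t with
  | zero => exact ⟨0, fun R _ A _ => ⟨∅, by simp⟩⟩
  | succ s ihs =>
    induction t with
    | zero => exact ⟨0, fun R _ A _ => ⟨∅, by simp⟩⟩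
    | succ t iht =>
      obtain ⟨n₁, h₁⟩ := ihs (t + 1)
      obtain ⟨n₂, h₂⟩ := iht
      refine ⟨n₁ + n₂ + 1, fun {α} R hR A hA => ?_⟩
      obtain ⟨x, hx⟩ : A.Nonempty := card_pos.mp (by omega)
      have hcard : #((A.erase x).filter (R x)) + #((A.erase x).filter fun y => ¬ R x y)
          = #A - 1 := by
        rw [card_filter_add_card_filter_not, card_erase_of_mem hx]
      have hsub : ∀ (P : α → Prop) [DecidablePred P], ∀ B ⊆ (A.erase x).filter P,
          insert x B ⊆ A ∧ x ∉ B ∧ ∀ y ∈ B, P y := by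
        intro P _ B hB
        refine ⟨insert_subset hx fun y hy => ?_, fun h => ?_, fun y hy => ?_⟩
        · exact mem_of_mem_erase (mem_filter.mp (hB hy)).1
        · exact notMem_erase x A (mem_filter.mp (hB h)).1
        · exact (mem_filter.mp (hB hy)).2
      rcases le_or_gt n₁ #((A.erase x).filter (R x)) with h | h
      · obtain ⟨B, hB, ⟨hc, hp⟩ | hp⟩ := h₁ R hR _ h
        · obtain ⟨hi, hxB, hP⟩ := hsub _ B hB
          refine ⟨insert x B, hi, Or.inl ⟨by rw [card_insert_of_notMem hxB, hc], ?_⟩⟩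
          rw [coe_insert]
          exact hp.insert fun y hy _ => ⟨hP y hy, hR _ _ (hP y hy)⟩
        · exact ⟨B, hB.trans ((filter_subset _ _).trans (erase_subset _ _)), Or.inr hp⟩
      · obtain ⟨B, hB, hp | ⟨hc, hp⟩⟩ := h₂ R hR ((A.erase x).filter fun y => ¬ R x y) (by omega)
        · exact ⟨B, hB.trans ((filter_subset _ _).trans (erase_subset _ _)), Or.inl hp⟩
        · obtain ⟨hi, hxB, hP⟩ := hsub _ B hB
          refine ⟨insert x B, hi, Or.inr ⟨by rw [card_insert_of_notMem hxB, hc], ?_⟩⟩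
          rw [coe_insert]
          exact hp.insert fun y hy _ => ⟨hP y hy, fun h => hP y hy (hR _ _ h)⟩

open Finset in
/-- The number of sequences whose term at `l` lies in a set of at most `M` elements that is
determined by two other terms. -/
theorem card_filter_mem_le {α : Type*} [Fintype α] [DecidableEq α] {m M : ℕ}
    (B : α → α → Finset α) (hB : ∀ x y, #(B x y) ≤ M) {i j l : Fin m} (hi : l ≠ i) (hj : l ≠ j) :
    #{f : Fin m → α | f l ∈ B (f i) (f j)} ≤ Fintype.card α ^ (m - 1) * M := by
  have hmaps : ∀ f ∈ ({f : Fin m → α | f l ∈ B (f i) (f j)} : Finset _),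
      (fun k : {k // k ≠ l} => f k) ∈ (univ : Finset ({k // k ≠ l} → α)) := fun _ _ => mem_univ _
  rw [card_eq_sum_card_fiberwise hmaps]
  have hfib : ∀ g ∈ (univ : Finset ({k // k ≠ l} → α)),
      #{f ∈ ({f : Fin m → α | f l ∈ B (f i) (f j)} : Finset _) |
        (fun k : {k // k ≠ l} => f k) = g} ≤ M := by
    intro g _
    refine le_trans (card_le_card_of_injOn (fun f => f l) (t := B (g ⟨i, hi.symm⟩) (g ⟨j, hj.symm⟩))
      ?_ ?_) (hB _ _)
    · intro f hf
      simp only [coe_filter, mem_filter, mem_univ, true_and, Set.mem_ofPred_eq] at hf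
      obtain ⟨hf, rfl⟩ := hf
      exact hf
    · intro f hf f' hf' h
      simp only [coe_filter, mem_filter, mem_univ, true_and, Set.mem_ofPred_eq] at hf hf'
      funext k
      by_cases hk : k = l
      · exact hk ▸ h
      · exact congrFun (hf.2.trans hf'.2.symm) ⟨k, hk⟩
  refine (sum_le_card_nsmul _ _ _ hfib).trans ?_
  simp [Fintype.card_subtype_compl]

open Finset in
/-- If all the sets `B x y` are small, then some sequence of length `m` has no term that lies in
`B x y` for two other terms `x`, `y`. -/
theorem exists_sequence_avoiding {α : Type*} [Fintype α] [DecidableEq α] {m M : ℕ}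
    (B : α → α → Finset α) (hB : ∀ x y, #(B x y) ≤ M) (h : m ^ 3 * M < Fintype.card α) :
    ∃ f : Fin m → α, ∀ i j l, l ≠ i → l ≠ j → f l ∉ B (f i) (f j) := by
  rcases Nat.eq_zero_or_pos m with rfl | hm
  · exact ⟨Fin.elim0, fun i => i.elim0⟩
  by_contra! hcon
  have hN : 0 < Fintype.card α := by omega
  have hcover : (univ : Finset (Fin m → α)) ⊆
      ({q : Fin m × Fin m × Fin m | q.2.2 ≠ q.1 ∧ q.2.2 ≠ q.2.1} : Finset _).biUnion
        fun q => {f : Fin m → α | f q.2.2 ∈ B (f q.1) (f q.2.1)} := by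
    intro f _
    obtain ⟨i, j, l, hi, hj, hf⟩ := hcon f
    simp only [mem_biUnion, mem_filter, mem_univ, true_and]
    exact ⟨(i, j, l), ⟨hi, hj⟩, hf⟩
  have hle := (card_le_card hcover).trans (card_biUnion_le_card_mul _ _ _ fun q hq => by
    simp only [mem_filter, mem_univ, true_and] at hq
    exact card_filter_mem_le B hB hq.1 hq.2)
  have htriples : #({q : Fin m × Fin m × Fin m | q.2.2 ≠ q.1 ∧ q.2.2 ≠ q.2.1} : Finset _)
      ≤ m ^ 3 := by
    refine (card_filter_le _ _).trans (le_of_eq ?_)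
    simp only [card_univ, Fintype.card_prod, Fintype.card_fin]
    ring
  have hcard : #(univ : Finset (Fin m → α)) = Fintype.card α ^ (m - 1) * Fintype.card α := by
    rw [card_univ, Fintype.card_fun, Fintype.card_fin, ← pow_succ, Nat.sub_add_cancel hm]
  have : Fintype.card α ^ (m - 1) * Fintype.card α ≤ Fintype.card α ^ (m - 1) * (m ^ 3 * M) := by
    rw [← hcard]
    calc _ ≤ _ := hle
      _ ≤ m ^ 3 * (Fintype.card α ^ (m - 1) * M) := Nat.mul_le_mul_right _ htriples
      _ = _ := by ring
  exact absurd (Nat.le_of_mul_le_mul_left this (pow_pos hN _)) (by omega)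

/-- On a finite set of points every half-space agrees with an open one. -/
theorem IsHalfSpace.exists_lt_iff_mem {H : Set (EuclideanSpace ℝ (Fin 3))} (hH : IsHalfSpace H)
    (P : Finset (EuclideanSpace ℝ (Fin 3))) :
    ∃ (a : EuclideanSpace ℝ (Fin 3)) (c : ℝ), a ≠ 0 ∧ ∀ x ∈ P, inner ℝ a x < c ↔ x ∈ H := by
  obtain ⟨a, b, ha, rfl | rfl⟩ := hH
  · classical
    obtain ⟨c, hc, hP⟩ : ∃ c, b < c ∧ ∀ x ∈ P, b < inner ℝ a x → c ≤ inner ℝ a x := by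
      induction P using Finset.induction_on with
      | empty => exact ⟨b + 1, by simp, by simp⟩
      | insert y P _ ih =>
        obtain ⟨c, hc, hP⟩ := ih
        by_cases hy : b < inner ℝ a y
        · refine ⟨min c (inner ℝ a y), lt_min hc hy, fun x hx hbx => ?_⟩
          rcases Finset.mem_insert.mp hx with rfl | hx
          · exact min_le_right _ _
          · exact (min_le_left _ _).trans (hP x hx hbx)
        · refine ⟨c, hc, fun x hx hbx => ?_⟩
          rcases Finset.mem_insert.mp hx with rfl | hx
          · exact absurd hbx hy
          · exact hP x hx hbx
    refine ⟨a, c, ha, fun x hx => ⟨fun h => ?_, fun h => lt_of_le_of_lt h hc⟩⟩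
    exact not_lt.mp fun hb => absurd (hP x hx hb) (not_le.mpr h)
  · exact ⟨a, b, ha, fun x _ => Iff.rfl⟩

open Finset in
/-- Reals with sum zero, one of them zero, cannot have at most two positive entries if, for every
pair of indices, they are orthogonal to a vector that is negative exactly on that pair. -/
theorem two_lt_card_pos_of_orthogonal (lam : Fin 6 → ℝ) (hlast : lam 5 = 0)
    (hpos : ∃ i, 0 < lam i) (g : Fin 6 → Fin 6 → Fin 6 → ℝ)
    (hg : ∀ i j, i ≠ j → ∀ l, g i j l < 0 ↔ l = i ∨ l = j)
    (hsum : ∀ i j, ∑ l, lam l * g i j l = 0) : 2 < #{i | 0 < lam i} := by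
  by_contra! hcard
  obtain ⟨i, hi⟩ := hpos
  -- A pair covering all positive entries makes every term of its sum nonpositive and the term at
  -- `i` negative. If `i` is the only positive entry, the zero entry 5 completes the pair.
  obtain ⟨j, hij, hj, hrest⟩ : ∃ j, i ≠ j ∧ 0 ≤ lam j ∧ ∀ l, l ≠ i → l ≠ j → lam l ≤ 0 := by
    by_cases h : ∃ j, i ≠ j ∧ 0 < lam j
    · obtain ⟨j, hij, hj⟩ := h
      refine ⟨j, hij, hj.le, fun l hli hlj => not_lt.mp fun hl => ?_⟩
      have hsub : ({i, j, l} : Finset (Fin 6)) ⊆ ({i | 0 < lam i} : Finset _) := by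
        intro x hx
        simp only [mem_insert, mem_singleton] at hx
        rcases hx with rfl | rfl | rfl <;> simpa
      have := card_le_card hsub
      rw [card_eq_three.mpr ⟨i, j, l, hij, hli.symm, hlj.symm, rfl⟩] at this
      omega
    · push Not at h
      refine ⟨5, fun h5 => ?_, hlast.ge, fun l hl _ => h l hl.symm⟩
      rw [h5, hlast] at hi
      exact lt_irrefl _ hi
  have hneg : ∑ l, lam l * g i j l < ∑ _l : Fin 6, (0 : ℝ) := by
    refine sum_lt_sum (fun l _ => ?_) ⟨i, mem_univ _, ?_⟩
    · by_cases hl : l = i ∨ l = j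
      · refine mul_nonpos_of_nonneg_of_nonpos ?_ ((hg i j hij l).mpr hl).le
        rcases hl with rfl | rfl
        · exact hi.le
        · exact hj
      · have h0 : 0 ≤ g i j l := not_lt.mp fun h => hl ((hg i j hij l).mp h)
        rw [not_or] at hl
        exact mul_nonpos_of_nonpos_of_nonneg (hrest l hl.1 hl.2) h0
    · exact mul_neg_of_pos_of_neg hi ((hg i j hij i).mpr (Or.inl rfl))
  rw [hsum i j, sum_const_zero] at hneg
  exact lt_irrefl _ hneg

open Finset in
/-- Six open half-spaces whose normals lie on one side of a coordinate plane cannot have, for every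
two of them, a point that lies in these two and in no others. -/
theorem not_forall_pair_lt_iff (a : Fin 6 → EuclideanSpace ℝ (Fin 3)) (c : Fin 6 → ℝ) (q : Fin 3)
    (s : ℝ) (hs : ∀ l, 0 < s * a l q) (p : Fin 6 → Fin 6 → EuclideanSpace ℝ (Fin 3))
    (hp : ∀ i j, i ≠ j → ∀ l, inner ℝ (a l) (p i j) < c l ↔ l = i ∨ l = j) : False := by
  -- Five vectors in a space of dimension 4 are dependent; the sixth half-space gets coefficient 0.
  let φ : (Fin 5 → ℝ) →ₗ[ℝ] EuclideanSpace ℝ (Fin 3) × ℝ :=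
    Fintype.linearCombination ℝ fun l : Fin 5 => (a l.castSucc, c l.castSucc)
  have hker : LinearMap.ker φ ≠ ⊥ := by
    refine LinearMap.ker_ne_bot_of_finrank_lt ?_
    simp
  obtain ⟨μ, hμ, hμ0⟩ := (Submodule.ne_bot_iff _).mp hker
  obtain ⟨lam, hlast, ha, hc, hne⟩ : ∃ lam : Fin 6 → ℝ, lam 5 = 0 ∧ ∑ l, lam l • a l = 0 ∧
      ∑ l, lam l * c l = 0 ∧ ∃ i, lam i ≠ 0 := by
    rw [LinearMap.mem_ker, Fintype.linearCombination_apply] at hμ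
    have hlast : (Fin.snoc μ 0 : Fin 6 → ℝ) 5 = 0 := Fin.snoc_last (α := fun _ => ℝ) _ _
    refine ⟨Fin.snoc μ 0, hlast, ?_, ?_, ?_⟩
    · have := congrArg Prod.fst hμ
      rw [Prod.fst_sum] at this
      rw [Fin.sum_univ_castSucc]
      simpa [hlast] using this
    · have := congrArg Prod.snd hμ
      rw [Prod.snd_sum] at this
      rw [Fin.sum_univ_castSucc]
      simpa [hlast] using this
    · obtain ⟨i, hi⟩ := Function.ne_iff.mp hμ0
      exact ⟨i.castSucc, by simpa using hi⟩
  have hg : ∀ i j, i ≠ j → ∀ l, inner ℝ (a l) (p i j) - c l < 0 ↔ l = i ∨ l = j := fun i j hij l =>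
    sub_neg.trans (hp i j hij l)
  have hsum : ∀ i j, ∑ l, lam l * (inner ℝ (a l) (p i j) - c l) = 0 := by
    intro i j
    have := congrArg (fun x => inner ℝ x (p i j)) ha
    simp only [sum_inner, real_inner_smul_left, inner_zero_left] at this
    simp only [mul_sub, sum_sub_distrib, this, hc, sub_zero]
  have hcoord : ∑ l, lam l * (s * a l q) = 0 := by
    have : ∑ l, lam l * a l q = 0 := by
      have := congrArg (fun x : EuclideanSpace ℝ (Fin 3) => x q) ha
      simpa using this
    calc _ = s * ∑ l, lam l * a l q := by
          rw [mul_sum]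
          exact sum_congr rfl fun l _ => by ring
      _ = 0 := by rw [this, mul_zero]
  -- Because the normals lie strictly on one side, a nontrivial dependence has coefficients of both
  -- signs.
  have hex : ∀ ν : Fin 6 → ℝ, ∑ l, ν l * (s * a l q) = 0 → (∃ i, ν i ≠ 0) → ∃ i, 0 < ν i := by
    intro ν hν ⟨i, hi⟩
    by_contra! hcon
    have := (sum_eq_zero_iff_of_nonpos fun l _ =>
      mul_nonpos_of_nonpos_of_nonneg (hcon l) (hs l).le).mp hν i (mem_univ _)
    exact hi ((mul_eq_zero.mp this).resolve_right (hs i).ne')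
  have h1 := two_lt_card_pos_of_orthogonal lam hlast (hex lam hcoord hne) _ hg hsum
  have h2 := two_lt_card_pos_of_orthogonal (-lam) (by simp [hlast])
    (hex (-lam) (by simpa using hcoord) (by simpa using hne)) _ hg (by simpa using hsum)
  have hdisj : Disjoint ({i | 0 < lam i} : Finset (Fin 6)) ({i | 0 < (-lam) i} : Finset _) := by
    rw [disjoint_filter]
    intro i _ h h'
    rw [Pi.neg_apply] at h'
    linarith
  have hsub : ({i | 0 < lam i} : Finset (Fin 6)) ∪ ({i | 0 < (-lam) i} : Finset _) ⊆ univ.erase 5 := by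
    intro i hi
    refine mem_erase.mpr ⟨?_, mem_univ _⟩
    rintro rfl
    simp [hlast] at hi
  have := card_le_card hsub
  rw [card_union_of_disjoint hdisj, card_erase_of_mem (mem_univ _), card_univ,
    Fintype.card_fin] at this
  omega

open Finset in
/-- Of 31 half-spaces, some two have no point that lies in these two and in no others. -/
theorem not_pairwise_exists_mem_iff {ι : Type*} (H : ι → Set (EuclideanSpace ℝ (Fin 3)))
    (hH : ∀ i, IsHalfSpace (H i)) (B : Finset ι) (hB : #B = 31)
    (w : ι → ι → EuclideanSpace ℝ (Fin 3))
    (hw : ∀ i ∈ B, ∀ j ∈ B, i ≠ j → ∀ l ∈ B, w i j ∈ H l ↔ l = i ∨ l = j) : False := by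
  classical
  choose a c ha hac using fun i =>
    (hH i).exists_lt_iff_mem ((B ×ˢ B).image fun x => w x.1 x.2)
  have hcoord : ∀ i, ∃ x : Fin 3 × Bool, 0 < (if x.2 then (1 : ℝ) else -1) * a i x.1 := by
    intro i
    obtain ⟨q, hq⟩ : ∃ q, a i q ≠ 0 := by
      by_contra! h
      exact ha i (by ext q; simpa using h q)
    rcases lt_or_gt_of_ne hq with h | h
    · exact ⟨(q, false), by simpa using h⟩
    · exact ⟨(q, true), by simpa using h⟩
  choose cls hcls using hcoord
  -- There are 6 classes (coordinate, sign) and 31 = 6 · 5 + 1.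
  obtain ⟨x, -, hx⟩ := exists_lt_card_fiber_of_mul_lt_card_of_maps_to (s := B) (t := univ)
    (f := cls) (n := 5) (fun _ _ => mem_univ _) (by simp [hB])
  obtain ⟨D, hD, hDcard⟩ := exists_subset_card_eq (Nat.succ_le_of_lt hx)
  let e := D.equivFinOfCardEq hDcard
  have hmem : ∀ n, (e.symm n : ι) ∈ B ∧ cls (e.symm n) = x := fun n =>
    mem_filter.mp (hD (e.symm n).2)
  have hinj : ∀ n n', (e.symm n : ι) = e.symm n' ↔ n = n' := fun n n' => by
    rw [Subtype.coe_inj, e.symm.injective.eq_iff]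
  refine not_forall_pair_lt_iff (fun n => a (e.symm n)) (fun n => c (e.symm n)) x.1
    (if x.2 then 1 else -1) (fun n => ?_) (fun n n' => w (e.symm n) (e.symm n')) ?_
  · have := hcls (e.symm n)
    rwa [(hmem n).2] at this
  · intro n n' hne l
    rw [hac _ _ (mem_image.mpr ⟨(_, _), mem_product.mpr ⟨(hmem n).1, (hmem n').1⟩, rfl⟩),
      hw _ (hmem n).1 _ (hmem n').1 (fun h => hne ((hinj _ _).mp h)) _ (hmem l).1,
      hinj, hinj]

open Finset in
/-- Many half-spaces such that no point of `V` lies in too many of them contain `r` half-spaces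
that are pairwise disjoint on `V`. -/
theorem exists_pairwise_disjoint (r : ℕ) : ∃ m : ℕ, ∀ {ι : Type}
    (H : ι → Set (EuclideanSpace ℝ (Fin 3))) (_ : ∀ i, IsHalfSpace (H i))
    (V : Set (EuclideanSpace ℝ (Fin 3))) (s : Finset ι) (M : ℕ)
    (_ : ∀ p ∈ V, {i ∈ (s : Set ι) | p ∈ H i}.ncard ≤ M) (_ : m ^ 3 * (M + 1) < #s),
    ∃ f : Fin r → ι, Function.Injective f ∧ (∀ t, f t ∈ s) ∧
      ∀ t t', t ≠ t' → (H (f t) ∩ V) ∩ (H (f t') ∩ V) = ∅ := by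
  classical
  obtain ⟨m, hm⟩ := exists_ramsey_number 31 r
  refine ⟨m, fun {ι} H hH V s M hM hs => ?_⟩
  let R : ι → ι → Prop := fun i j => ((H i ∩ V) ∩ (H j ∩ V)).Nonempty
  have hR : ∀ i j, ∃ w : EuclideanSpace ℝ (Fin 3), R i j → w ∈ (H i ∩ V) ∩ (H j ∩ V) := by
    intro i j
    by_cases h : R i j
    · exact ⟨h.some, fun _ => h.some_mem⟩
    · exact ⟨0, fun h' => absurd h' h⟩
  choose w hw using hR
  -- Inserting `x` itself makes the terms of the avoiding sequence distinct, at the cost of the `+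
  -- 1`.
  have hB : ∀ x y : s, #(insert x ({z : s | R x y ∧ w x y ∈ H z} : Finset s)) ≤ M + 1 := by
    intro x y
    refine (card_insert_le _ _).trans (Nat.succ_le_succ ?_)
    by_cases h : R x y
    · refine le_trans ?_ (hM _ (hw _ _ h).1.2)
      rw [← Set.ncard_coe_finset]
      refine Set.ncard_le_ncard_of_injOn Subtype.val (fun z hz => ?_)
        Subtype.val_injective.injOn (s.finite_toSet.subset fun i hi => hi.1)
      simp only [coe_filter, mem_univ, true_and, Set.mem_ofPred_eq] at hz
      exact ⟨z.2, hz.2⟩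
    · simp [h]
  obtain ⟨f, hf⟩ := exists_sequence_avoiding (m := m) _ hB (by simpa using hs)
  simp only [mem_insert, mem_filter, mem_univ, true_and, not_or, not_and] at hf
  have hfinj : ∀ i j, (f i : ι) = f j → i = j := fun i j h => by
    by_contra hne
    exact (hf j j i hne hne).1 (Subtype.ext h)
  obtain ⟨B, -, ⟨hB, hp⟩ | ⟨hB, hp⟩⟩ := hm (fun i j => R (f i) (f j))
    (fun i j h => by simpa only [R, Set.inter_comm] using h) univ (by simp)
  · refine (not_pairwise_exists_mem_iff (fun i => H (f i)) (fun i => hH _) B hB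
      (fun i j => w (f i) (f j)) fun i hi j hj hij l _ => ⟨fun h => ?_, ?_⟩).elim
    · by_contra! hl
      exact (hf i j l hl.1 hl.2).2 (hp hi hj hij) h
    · rintro (rfl | rfl)
      · exact (hw _ _ (hp hi hj hij)).1.1
      · exact (hw _ _ (hp hi hj hij)).2.1
  · let e := B.equivFinOfCardEq hB
    have hinj : ∀ t t', (e.symm t : Fin m) = e.symm t' → t = t' := fun t t' h =>
      e.symm.injective (Subtype.ext h)
    refine ⟨fun t => f (e.symm t), fun t t' h => hinj _ _ (hfinj _ _ h), fun t => (f _).2,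
      fun t t' hne => ?_⟩
    exact Set.not_nonempty_iff_eq_empty.mp
      (hp (e.symm t).2 (e.symm t').2 fun h => hne (hinj _ _ h))

open Finset in
/-- More than `K ^ k` half-spaces with distinct traces of size `k` on `V` contain a sunflower. -/
theorem exists_isSunflower (r : ℕ) : ∃ K : ℕ, ∀ {ι : Type}
    (H : ι → Set (EuclideanSpace ℝ (Fin 3))) (_ : ∀ i, IsHalfSpace (H i)) (k : ℕ)
    (V : Set (EuclideanSpace ℝ (Fin 3))) (s : Finset ι)
    (_ : ∀ i ∈ s, (H i ∩ V).encard = k) (_ : Set.InjOn (fun i => H i ∩ V) s) (_ : K ^ k < #s),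
    ∃ f : Fin r → ι, (∀ t, f t ∈ s) ∧ IsSunflower r fun t => H (f t) ∩ V := by
  classical
  obtain ⟨m, hm⟩ := exists_pairwise_disjoint r
  refine ⟨2 * m ^ 3 + 1, fun {ι} H hH k => ?_⟩
  set K := 2 * m ^ 3 + 1 with hK
  induction k with
  | zero =>
    intro V s hcard hinj hs
    obtain ⟨i, hi, j, hj, hij⟩ := one_lt_card.mp (by simpa using hs)
    refine absurd (hinj hi hj ?_) hij
    have h0 : ∀ l ∈ s, H l ∩ V = ∅ := fun l hl => Set.encard_eq_zero.mp (by simpa using hcard l hl)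
    exact (h0 i hi).trans (h0 j hj).symm
  | succ k ih =>
    intro V s hcard hinj hs
    by_cases hheavy : ∃ p ∈ V, #s / K < #{i ∈ s | p ∈ H i}
    · obtain ⟨p, hpV, hp⟩ := hheavy
      have hdiff : ∀ i ∈ ({i ∈ s | p ∈ H i} : Finset ι),
          p ∉ H i ∩ (V \ {p}) ∧ H i ∩ V = insert p (H i ∩ (V \ {p})) := by
        intro i hi
        refine ⟨fun h => h.2.2 rfl, ?_⟩
        rw [← Set.inter_sdiff_assoc, Set.insert_sdiff_singleton, Set.insert_eq_of_mem]
        exact ⟨(mem_filter.mp hi).2, hpV⟩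
      have hcard' : ∀ i ∈ ({i ∈ s | p ∈ H i} : Finset ι), (H i ∩ (V \ {p})).encard = k := by
        intro i hi
        have := hcard i (mem_filter.mp hi).1
        rw [(hdiff i hi).2, Set.encard_insert_of_notMem (hdiff i hi).1, Nat.cast_succ] at this
        exact WithTop.add_right_cancel ENat.one_ne_top this
      have hinj' : Set.InjOn (fun i => H i ∩ (V \ {p})) ({i ∈ s | p ∈ H i} : Finset ι) := by
        intro i hi j hj h
        have h' : H i ∩ (V \ {p}) = H j ∩ (V \ {p}) := h
        refine hinj (mem_filter.mp hi).1 (mem_filter.mp hj).1 ?_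
        simp only
        rw [(hdiff i hi).2, (hdiff j hj).2, h']
      have hlarge : K ^ k < #{i ∈ s | p ∈ H i} := by
        refine lt_of_le_of_lt ?_ hp
        rw [Nat.le_div_iff_mul_le (by omega), ← pow_succ]
        exact hs.le
      obtain ⟨f, hfs, hf, hfi⟩ := ih (V \ {p}) _ hcard' hinj' hlarge
      have hfe : ∀ t, H (f t) ∩ V = insert p (H (f t) ∩ (V \ {p})) := fun t =>
        (hdiff _ (hfs t)).2
      refine ⟨f, fun t => (mem_filter.mp (hfs t)).1, fun t t' h => hf ?_, ?_⟩
      · have h' : H (f t) ∩ V = H (f t') ∩ V := h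
        simp only [← Set.inter_sdiff_assoc, h']
      · intro i j i' j' hij hij'
        simp only [hfe, ← Set.insert_inter_distrib]
        exact congrArg _ (hfi i j i' j' hij hij')
    · push Not at hheavy
      have hlight : ∀ p ∈ V, {i ∈ (s : Set ι) | p ∈ H i}.ncard ≤ #s / K := by
        intro p hp
        refine le_trans (le_of_eq ?_) (hheavy p hp)
        rw [← Set.ncard_coe_finset, coe_filter]
        rfl
      -- With q = `#s / K` ≥ 1, m³(q + 1) ≤ 2m³q < Kq ≤ `#s`; this dictates `K`.
      have hlarge : m ^ 3 * (#s / K + 1) < #s := by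
        have hKs : K ≤ #s := (Nat.le_self_pow (Nat.succ_ne_zero k) K).trans hs.le
        have h1 : K * (#s / K) ≤ #s := Nat.mul_div_le _ _
        have h2 : 1 ≤ #s / K := (Nat.one_le_div_iff (by omega)).mpr hKs
        have h3 : m ^ 3 * (#s / K + 1) ≤ m ^ 3 * (2 * (#s / K)) := Nat.mul_le_mul_left _ (by omega)
        have h4 : K * (#s / K) = m ^ 3 * (2 * (#s / K)) + #s / K := by rw [hK]; ring
        omega
      obtain ⟨f, hf, hfs, hfd⟩ := hm H hH V s (#s / K) hlight hlarge
      refine ⟨f, hfs, fun t t' h => hf (hinj (hfs t) (hfs t') h), fun i j i' j' hij hij' => ?_⟩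
      exact (hfd i j hij).trans (hfd i' j' hij').symm

theorem mainTheorem6 (r : ℕ) (hr : 2 < r) :
    ∃ C : ℝ, 0 < C ∧
      ∀ (k N : ℕ) (V : Set (EuclideanSpace ℝ (Fin 3)))
        (H : Fin N → Set (EuclideanSpace ℝ (Fin 3))),
        1 ≤ k →
        (∀ i, IsHalfSpace (H i)) →
        (∀ i, (H i ∩ V).encard = k) →
        Function.Injective (fun i => H i ∩ V) →
        C ^ k ≤ (N : ℝ) →
        ∃ f : Fin r → Fin N, IsSunflower r (fun t => H (f t) ∩ V) := by
  obtain ⟨K, hK⟩ := exists_isSunflower r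
  -- The extra 1 gives the strict bound, since `k` ≥ 1.
  refine ⟨K + 1, by positivity, fun k N V H hk hH hcard hinj hN => ?_⟩
  have hlarge : K ^ k < (Finset.univ : Finset (Fin N)).card := by
    rw [Finset.card_univ, Fintype.card_fin]
    refine lt_of_lt_of_le (Nat.pow_lt_pow_left (Nat.lt_succ_self K) (by omega)) ?_
    exact_mod_cast hN
  obtain ⟨f, -, hf⟩ := hK H hH k V Finset.univ (fun i _ => hcard i) hinj.injOn hlarge
  exact ⟨f, hf⟩
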